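/- All graphs are simple, undirected, connected and locally finite (possibly infinite). For a graph $G=(V,E)$ with combinatorial distance $d$ and vertex degrees $d_x$, for $x\in V$ and $p\in[0,1]$, let $\mu_x^p$ be the function on $V$ with $\mu_x^p(x)=p$, $\mu_x^p(z)=\frac{1-p}{d_x}$ if $z\sim x$, and $\mu_x^p(z)=0$ otherwise. For an edge $\{x,y\}\in E$ let $$\kappa_p(x,y)=1-W_1(\mu_x^p,\mu_y^p),\qquad \kappa_{LLY}(x,y)=\lim_{p\to 1^-}\frac{\kappa_p(x,y)}{1-p},$$ where $W_1(\mu_1,\mu_2)=\inf_\pi\sum_{v,w\in V}d(v,w)\pi(v,w)$, the infimum being over all $\pi:V\times V\to[0,\infty)$ with $\sum_{w}\pi(v,w)=\mu_1(v)$ and $\sum_{v}\pi(v,w)=\mu_2(w)$ for all $v,w\in V$. The strong product $G\boxtimes H$ of $G=(V_G,E_G)$ and $H=(V_H,E_H)$ has vertex set $V_G\times V_H$, and its edges are the horizontal edges $\{(x_1,y),(x_2,y)\}$ with $x_1\sim x_2$ in $G$, the vertical edges $\{(x,y_1),(x,y_2)\}$ with $y_1\sim y_2$ in $H$, and the diagonal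 edges $\{(x_1,y_1),(x_2,y_2)\}$ with $x_1\sim x_2$ in $G$ and $y_1\sim y_2$ in $H$. **Corollary.** Let $G$ and $H$ be regular graphs. (a) If $\kappa_0\ge 0$ on all edges of $G$ and on all edges of $H$, then $\kappa_0\ge 0$ on all horizontal and all vertical edges of $G\boxtimes H$. (b) If $\kappa_{LLY}\ge 0$ on all edges of $G$ and on all edges of $H$, then on all horizontal and all vertical edges of $G\boxtimes H$ the limit defining $\kappa_{LLY}$ exists and $\kappa_{LLY}\ge 0$. -/

import Mathlib

open Filter Topology

namespace OllivierRicci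

universe u v

/-- The strong product of two simple graphs: its edges are the horizontal, the vertical and the
diagonal pairs, in this order in the disjunction below. -/
def strongProd {V : Type u} {W : Type v} (G : SimpleGraph V) (H : SimpleGraph W) :
    SimpleGraph (V × W) where
  Adj a b :=
    (G.Adj a.1 b.1 ∧ a.2 = b.2) ∨ (a.1 = b.1 ∧ H.Adj a.2 b.2) ∨ (G.Adj a.1 b.1 ∧ H.Adj a.2 b.2)
  symm := ⟨by
    rintro a b (⟨h, e⟩ | ⟨e, h⟩ | ⟨h, k⟩)
    · exact Or.inl ⟨h.symm, e.symm⟩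
    · exact Or.inr (Or.inl ⟨e.symm, h.symm⟩)
    · exact Or.inr (Or.inr ⟨h.symm, k.symm⟩)⟩
  loopless := ⟨by
    rintro a (⟨h, -⟩ | ⟨-, h⟩ | ⟨h, -⟩)
    · exact h.ne rfl
    · exact h.ne rfl
    · exact h.ne rfl⟩

/-- The strong product of two locally finite graphs is locally finite. -/
noncomputable instance strongProdLocallyFinite {V : Type u} {W : Type v} (G : SimpleGraph V)
    (H : SimpleGraph W) [G.LocallyFinite] [H.LocallyFinite] : (strongProd G H).LocallyFinite :=
  fun a => Set.Finite.fintype <| by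
    have hG : (insert a.1 (G.neighborSet a.1)).Finite := (Set.toFinite _).insert _
    have hH : (insert a.2 (H.neighborSet a.2)).Finite := (Set.toFinite _).insert _
    refine (hG.prod hH).subset ?_
    rintro ⟨b, c⟩ (⟨h, e⟩ | ⟨e, h⟩ | ⟨h, k⟩)
    · exact ⟨Or.inr h, Or.inl e.symm⟩
    · exact ⟨Or.inl e.symm, Or.inr h⟩
    · exact ⟨Or.inr h, Or.inr k⟩

open Classical in
/-- The mass function `μ_x^p` of the lazy random walk step with idleness `p` at the vertex `x`. -/
noncomputable def lazyMeasure {V : Type u} (G : SimpleGraph V) [G.LocallyFinite]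
    (p : ℝ) (x z : V) : ℝ :=
  if z = x then p else if G.Adj x z then (1 - p) / (G.degree x : ℝ) else 0

/-- `π` is a transport plan from `μ₁` to `μ₂`: it is non-negative with marginals `μ₁` and `μ₂`. -/
structure IsTransportPlan {V : Type u} (μ₁ μ₂ : V → ℝ) (π : V → V → ℝ) : Prop where
  nonneg : ∀ x y, 0 ≤ π x y
  hasSum_left : ∀ x, HasSum (fun y => π x y) (μ₁ x)
  hasSum_right : ∀ y, HasSum (fun x => π x y) (μ₂ y)

/-- The cost of a transport plan with respect to the combinatorial distance, as an extended
non-negative real, so that the (possibly infinite) sums always make sense. -/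
noncomputable def transportCost {V : Type u} (G : SimpleGraph V) (π : V → V → ℝ) : ENNReal :=
  ∑' y, ∑' x, ENNReal.ofReal ((G.dist x y : ℝ) * π x y)

/-- The Wasserstein distance `W₁(μ₁, μ₂)`: the infimum of the costs of all transport plans. -/
noncomputable def wasserstein {V : Type u} (G : SimpleGraph V) (μ₁ μ₂ : V → ℝ) : ENNReal :=
  ⨅ (π : V → V → ℝ) (_ : IsTransportPlan μ₁ μ₂ π), transportCost G π

/-- The `p`-Ollivier Ricci curvature `κ_p(x,y) = 1 - W₁(μ_x^p, μ_y^p)`. The Wasserstein distance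
here is finite, because the two measures have finite support. -/
noncomputable def kappa {V : Type u} (G : SimpleGraph V) [G.LocallyFinite]
    (p : ℝ) (x y : V) : ℝ :=
  1 - (wasserstein G (lazyMeasure G p x) (lazyMeasure G p y)).toReal

/-- The Lin-Lu-Yau curvature `κ_LLY(x,y) = lim_{p → 1} κ_p(x,y) / (1 - p)`; as the idleness lies
in `[0,1]`, this is a limit from the left. -/
noncomputable def kappaLLY {V : Type u} (G : SimpleGraph V) [G.LocallyFinite] (x y : V) : ℝ :=
  limUnder (𝓝[<] (1 : ℝ)) (fun p => kappa G p x y / (1 - p))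

/-- The limit defining `κ_LLY(x,y)` exists (so that `kappaLLY` is its value). -/
def HasKappaLLY {V : Type u} (G : SimpleGraph V) [G.LocallyFinite] (x y : V) : Prop :=
  Tendsto (fun p => kappa G p x y / (1 - p)) (𝓝[<] (1 : ℝ)) (𝓝 (kappaLLY G x y))

end OllivierRicci

/-! A step of the walk from `(x, y)` splits along the layers over the closed neighborhood of `y`. At
idleness `0` it is uniform on the open neighborhood of `x` in the layer of `y` together with the
closed neighborhood of `x` in the layer of each neighbor of `y`. At idleness `1 / n`, where `n` is
the size of the closed neighborhood of `(x, y)`, it is uniform on the product of the two closed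
neighborhoods. A horizontal edge is handled by transporting inside each layer, which costs no more
than in `G`.

Let `D` be the degree of `G`. Non-negative `κ_0` gives plans between open neighborhoods of cost
about `D` (`exists_finPlan_openInd_of_kappa`); sending `x` to its neighbor as well gives plans
between closed ones of cost about `D + 1`. Summed over the layers, the cost is about the degree in
the product, so `W₁ ≤ 1`.

For the Lin-Lu-Yau curvature, plans of cost about `D + 1` between closed neighborhoods come from
idleness near `1`. There the measure is a uniform part plus an excess at the center, and the
exchange argument `FinPlan.exists_peel` lets this excess travel along the edge
(`exists_finPlan_closedInd`). Layering gives `κ_{1/n} ≥ 0` in the product. As `κ_p / (1 - p)` is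
nondecreasing and bounded (`kappa_div_mono`, `kappa_le`), its limit exists and is non-negative.
Vertical edges follow by swapping the factors. -/

namespace OllivierRicci

/-! ### Finite transport plans and the exchange argument -/

section FinPlan

open scoped Classical

variable {V : Type*}

/-- A transport plan supported in `S × S` for a finite set `S`. -/
structure FinPlan (S : Finset V) (μ ν : V → ℝ) (π : V → V → ℝ) : Prop where
  nonneg : ∀ a b, 0 ≤ π a b
  off_left : ∀ a b, a ∉ S → π a b = 0
  off_right : ∀ a b, b ∉ S → π a b = 0
  row : ∀ a, ∑ b ∈ S, π a b = μ a
  col : ∀ b, ∑ a ∈ S, π a b = ν b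

/-- The cost of a finitely supported plan for the cost function `c`. -/
def finCost (c : V → V → ℝ) (S : Finset V) (π : V → V → ℝ) : ℝ :=
  ∑ a ∈ S, ∑ b ∈ S, c a b * π a b

variable {S : Finset V} {μ ν μ' ν' : V → ℝ} {π π' : V → V → ℝ} {c : V → V → ℝ}

lemma FinPlan.congr (h : FinPlan S μ ν π) (hμ : ∀ a, μ a = μ' a) (hν : ∀ a, ν a = ν' a) :
    FinPlan S μ' ν' π := by
  obtain rfl : μ = μ' := funext hμ
  obtain rfl : ν = ν' := funext hν
  exact h

lemma FinPlan.le_left (h : FinPlan S μ ν π) (a b : V) : π a b ≤ μ a := by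
  by_cases hb : b ∈ S
  · rw [← h.row a]
    exact Finset.single_le_sum (f := fun b => π a b) (fun i _ => h.nonneg a i) hb
  · rw [h.off_right a b hb, ← h.row a]
    exact Finset.sum_nonneg fun i _ => h.nonneg a i

lemma FinPlan.le_right (h : FinPlan S μ ν π) (a b : V) : π a b ≤ ν b := by
  by_cases ha : a ∈ S
  · rw [← h.col b]
    exact Finset.single_le_sum (f := fun a => π a b) (fun i _ => h.nonneg i b) ha
  · rw [h.off_left a b ha, ← h.col b]
    exact Finset.sum_nonneg fun i _ => h.nonneg i b

lemma FinPlan.add (h : FinPlan S μ ν π) (h' : FinPlan S μ' ν' π') :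
    FinPlan S (fun a => μ a + μ' a) (fun a => ν a + ν' a) (fun a b => π a b + π' a b) where
  nonneg a b := add_nonneg (h.nonneg a b) (h'.nonneg a b)
  off_left a b ha := by rw [h.off_left a b ha, h'.off_left a b ha, add_zero]
  off_right a b hb := by rw [h.off_right a b hb, h'.off_right a b hb, add_zero]
  row a := by rw [Finset.sum_add_distrib, h.row, h'.row]
  col b := by rw [Finset.sum_add_distrib, h.col, h'.col]

lemma finCost_add : finCost c S (fun a b => π a b + π' a b) = finCost c S π + finCost c S π' := by
  simp only [finCost, mul_add, Finset.sum_add_distrib]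

lemma FinPlan.smul (h : FinPlan S μ ν π) {t : ℝ} (ht : 0 ≤ t) :
    FinPlan S (fun a => t * μ a) (fun a => t * ν a) (fun a b => t * π a b) where
  nonneg a b := mul_nonneg ht (h.nonneg a b)
  off_left a b ha := by rw [h.off_left a b ha, mul_zero]
  off_right a b hb := by rw [h.off_right a b hb, mul_zero]
  row a := by rw [← Finset.mul_sum, h.row]
  col b := by rw [← Finset.mul_sum, h.col]

lemma finCost_smul (t : ℝ) : finCost c S (fun a b => t * π a b) = t * finCost c S π := by
  simp only [finCost, Finset.mul_sum, mul_left_comm]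

lemma finPlan_single {u v : V} (hu : u ∈ S) (hv : v ∈ S) {t : ℝ} (ht : 0 ≤ t) :
    FinPlan S (fun a => if a = u then t else 0) (fun b => if b = v then t else 0)
      (fun a b => if a = u ∧ b = v then t else 0) where
  nonneg a b := by split_ifs <;> simp [ht]
  off_left a b ha := if_neg fun h : a = u ∧ b = v => ha (h.1 ▸ hu)
  off_right a b hb := if_neg fun h : a = u ∧ b = v => hb (h.2 ▸ hv)
  row a := by by_cases h : a = u <;> simp [h, hv]
  col b := by by_cases h : b = v <;> simp [h, hu]

lemma finCost_single {u v : V} (hu : u ∈ S) (hv : v ∈ S) (t : ℝ) :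
    finCost c S (fun a b => if a = u ∧ b = v then t else 0) = c u v * t := by
  rw [finCost, Finset.sum_eq_single_of_mem u hu, Finset.sum_eq_single_of_mem v hv]
  · simp
  · intro b _ hb; simp [hb]
  · intro a _ ha; simp [ha]

lemma finPlan_diag {T : Finset V} (hT : T ⊆ S) {t : ℝ} (ht : 0 ≤ t) :
    FinPlan S (fun a => if a ∈ T then t else 0) (fun a => if a ∈ T then t else 0)
      (fun a b => if a = b ∧ a ∈ T then t else 0) where
  nonneg a b := by split_ifs <;> simp [ht]
  off_left a b ha := if_neg fun h : a = b ∧ a ∈ T => ha (hT h.2)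
  off_right a b hb := if_neg fun h : a = b ∧ a ∈ T => hb (h.1 ▸ hT h.2)
  row a := by
    by_cases h : a ∈ T
    · simp [h, hT h]
    · simp [h]
  col b := by
    by_cases h : b ∈ T
    · rw [Finset.sum_eq_single_of_mem b (hT h)]
      · simp [h]
      · intro a _ ha; simp [ha]
    · rw [if_neg h]
      refine Finset.sum_eq_zero fun a _ => if_neg ?_
      rintro ⟨rfl, h'⟩
      exact h h'

lemma finCost_diag {T : Finset V} {t : ℝ} (hc : ∀ a, c a a = 0) :
    finCost c S (fun a b => if a = b ∧ a ∈ T then t else 0) = 0 := by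
  refine Finset.sum_eq_zero fun a _ => Finset.sum_eq_zero fun b _ => ?_
  by_cases h : a = b
  · simp [h, hc]
  · simp [h]

lemma finPlan_prod (hμ : ∀ a, 0 ≤ μ a) (hν : ∀ a, 0 ≤ ν a) (hμS : ∀ a, a ∉ S → μ a = 0)
    (hνS : ∀ a, a ∉ S → ν a = 0) (hμ1 : ∑ a ∈ S, μ a = 1) (hν1 : ∑ a ∈ S, ν a = 1) :
    FinPlan S μ ν (fun a b => μ a * ν b) where
  nonneg a b := mul_nonneg (hμ a) (hν b)
  off_left a b ha := by rw [hμS a ha, zero_mul]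
  off_right a b hb := by rw [hνS b hb, mul_zero]
  row a := by rw [← Finset.mul_sum, hν1, mul_one]
  col b := by rw [← Finset.sum_mul, hμ1, one_mul]

/-- Mass `t` may be assumed to move from `u` to `v`, provided that exchanging the targets of `u` and
`a` never increases the cost. -/
lemma FinPlan.exists_peel {u v : V} {t : ℝ} (hu : u ∈ S) (hv : v ∈ S)
    (h : FinPlan S (fun a => μ a + if a = u then t else 0)
      (fun b => ν b + if b = v then t else 0) π) (hμ : 0 ≤ μ u) (hν : 0 ≤ ν v)
    (hc : ∀ a b, a ≠ u → 0 < μ a → b ≠ v → 0 < ν b → c a b + c u v ≤ c a v + c u b) :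
    ∃ π', FinPlan S μ ν π' ∧ finCost c S π' + c u v * t ≤ finCost c S π := by
  by_cases hle : t ≤ π u v
  · refine ⟨fun a b => π a b - if a = u ∧ b = v then t else 0, ⟨?_, ?_, ?_, ?_, ?_⟩, ?_⟩
    · intro a b
      split_ifs with hab
      · obtain ⟨rfl, rfl⟩ := hab; linarith
      · simpa using h.nonneg a b
    · intro a b ha
      have : ¬ (a = u ∧ b = v) := fun hab => ha (hab.1 ▸ hu)
      simp [this, h.off_left a b ha]
    · intro a b hb
      have : ¬ (a = u ∧ b = v) := fun hab => hb (hab.2 ▸ hv)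
      simp [this, h.off_right a b hb]
    · intro a
      rw [Finset.sum_sub_distrib, h.row]
      by_cases ha : a = u <;> simp [ha, hv]
    · intro b
      rw [Finset.sum_sub_distrib, h.col]
      by_cases hb : b = v <;> simp [hb, hu]
    · have := finCost_add (c := c) (S := S)
        (π := fun a b => π a b - if a = u ∧ b = v then t else 0)
        (π' := fun a b => if a = u ∧ b = v then t else 0)
      simp only [sub_add_cancel] at this
      rw [finCost_single hu hv] at this
      exact this.ge
  · push Not at hle
    -- `r` is the mass still missing on the pair `(u, v)`. `I` is what reaches `v` from points other
    -- than `u`, and `O` is what leaves `u` for points other than `v`; both are at least `r`.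
    obtain ⟨r, hr⟩ : ∃ r, r = t - π u v := ⟨_, rfl⟩
    have hr0 : 0 < r := by linarith
    obtain ⟨I, hI⟩ : ∃ I, I = ν v + r := ⟨_, rfl⟩
    obtain ⟨O, hO⟩ : ∃ O, O = μ u + r := ⟨_, rfl⟩
    have hI0 : 0 < I := by linarith
    have hO0 : 0 < O := by linarith
    -- Adding `r * (α a * β b)` takes `r` from the inflow of `v` and from the outflow of `u`,
    -- proportionally, puts `r` on `(u, v)`, and joins the freed sources to the freed targets. The
    -- marginals stay fixed because `α` and `β` sum to zero.
    obtain ⟨α, hα⟩ : ∃ α : V → ℝ, α = fun a => if a = u then -1 else π a v / I := ⟨_, rfl⟩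
    obtain ⟨β, hβ⟩ : ∃ β : V → ℝ, β = fun b => if b = v then -1 else π u b / O := ⟨_, rfl⟩
    have hαu : α u = -1 := by simp [hα]
    have hβv : β v = -1 := by simp [hβ]
    have hαne : ∀ a, a ≠ u → α a = π a v / I := fun a ha => by simp [hα, ha]
    have hβne : ∀ b, b ≠ v → β b = π u b / O := fun b hb => by simp [hβ, hb]
    have hα0 : ∑ a ∈ S, α a = 0 := by
      rw [← Finset.add_sum_erase S α hu, hαu,
        Finset.sum_congr rfl fun a ha => hαne a (Finset.ne_of_mem_erase ha), ← Finset.sum_div]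
      have h1 := Finset.add_sum_erase S (fun a => π a v) hu
      rw [h.col v, if_pos rfl] at h1
      have h2 : ∑ a ∈ S.erase u, π a v = I := by linarith
      rw [h2, div_self hI0.ne']; norm_num
    have hβ0 : ∑ b ∈ S, β b = 0 := by
      rw [← Finset.add_sum_erase S β hv, hβv,
        Finset.sum_congr rfl fun b hb => hβne b (Finset.ne_of_mem_erase hb), ← Finset.sum_div]
      have h1 := Finset.add_sum_erase S (fun b => π u b) hv
      rw [h.row u, if_pos rfl] at h1
      have h2 : ∑ b ∈ S.erase v, π u b = O := by linarith
      rw [h2, div_self hO0.ne']; norm_num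
    refine ⟨fun a b => π a b + r * (α a * β b) - if a = u ∧ b = v then t else 0,
      ⟨?_, ?_, ?_, ?_, ?_⟩, ?_⟩
    · intro a b
      by_cases ha : a = u <;> by_cases hb : b = v
      · subst ha hb
        rw [hαu, hβv, if_pos ⟨rfl, rfl⟩]; linarith
      · subst ha
        rw [hαu, hβne b hb, if_neg (fun h => hb h.2)]
        have : r * (π a b / O) ≤ π a b := by
          rw [mul_div_assoc', div_le_iff₀ hO0, mul_comm]
          exact mul_le_mul_of_nonneg_left (by linarith) (h.nonneg a b)
        linarith
      · subst hb
        rw [hβv, hαne a ha, if_neg (fun h => ha h.1)]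
        have : r * (π a b / I) ≤ π a b := by
          rw [mul_div_assoc', div_le_iff₀ hI0, mul_comm]
          exact mul_le_mul_of_nonneg_left (by linarith) (h.nonneg a b)
        linarith
      · rw [hαne a ha, hβne b hb, if_neg (fun h => ha h.1), sub_zero]
        exact add_nonneg (h.nonneg a b) (mul_nonneg hr0.le
          (mul_nonneg (div_nonneg (h.nonneg _ _) hI0.le) (div_nonneg (h.nonneg _ _) hO0.le)))
    · intro a b ha
      have hau : a ≠ u := fun e => ha (e ▸ hu)
      simp [hau, h.off_left _ _ ha, hαne a hau]
    · intro a b hb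
      have hbv : b ≠ v := fun e => hb (e ▸ hv)
      simp [hbv, h.off_right _ _ hb, hβne b hbv]
    · intro a
      rw [Finset.sum_sub_distrib, Finset.sum_add_distrib, h.row, ← Finset.mul_sum,
        ← Finset.mul_sum, hβ0]
      by_cases ha : a = u <;> simp [ha, hv]
    · intro b
      rw [Finset.sum_sub_distrib, Finset.sum_add_distrib, h.col, ← Finset.mul_sum,
        ← Finset.sum_mul, hα0]
      by_cases hb : b = v <;> simp [hb, hu]
    · have key : ∑ a ∈ S, ∑ b ∈ S, c a b * (α a * β b) ≤ 0 := by
        -- Since `α` and `β` have sum zero, terms of the cost that depend on one variable only are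
        -- free. The normalized cost vanishes for `a = u` or `b = v`, and is non-positive by the
        -- exchange hypothesis wherever `α` and `β` are both positive.
        have e : ∑ a ∈ S, ∑ b ∈ S, c a b * (α a * β b)
            = ∑ a ∈ S, ∑ b ∈ S, (c a b + c u v - c a v - c u b) * (α a * β b) := by
          have e1 : ∑ a ∈ S, ∑ b ∈ S, c u v * (α a * β b) = 0 := by
            simp only [← Finset.mul_sum, hβ0, mul_zero, Finset.sum_const_zero]
          have e2 : ∑ a ∈ S, ∑ b ∈ S, c a v * (α a * β b) = 0 := by
            simp only [← Finset.mul_sum, hβ0, mul_zero, Finset.sum_const_zero]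
          have e3 : ∑ a ∈ S, ∑ b ∈ S, c u b * (α a * β b) = 0 := by
            rw [Finset.sum_comm]
            simp only [← Finset.mul_sum, ← Finset.sum_mul, hα0, zero_mul, mul_zero,
              Finset.sum_const_zero]
          simp only [sub_mul, add_mul, Finset.sum_sub_distrib, Finset.sum_add_distrib, e1, e2, e3]
          ring
        rw [e]
        refine Finset.sum_nonpos fun a _ => Finset.sum_nonpos fun b _ => ?_
        by_cases ha : a = u
        · subst ha
          exact (by ring : (c a b + c a v - c a v - c a b) * (α a * β b) = 0).le
        by_cases hb : b = v
        · subst hb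
          exact (by ring : (c a b + c u b - c a b - c u b) * (α a * β b) = 0).le
        rw [hαne a ha, hβne b hb]
        have hav := h.le_left a v
        have hub := h.le_right u b
        rw [if_neg ha, add_zero] at hav
        rw [if_neg hb, add_zero] at hub
        rcases (h.nonneg a v).eq_or_lt with h0 | h1
        · rw [← h0]; simp
        rcases (h.nonneg u b).eq_or_lt with h0 | h2
        · rw [← h0]; simp
        have := hc a b ha (h1.trans_le hav) hb (h2.trans_le hub)
        exact mul_nonpos_of_nonpos_of_nonneg (by linarith) (by positivity)
      have e4 := finCost_add (c := c) (S := S)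
        (π := fun a b => π a b + r * (α a * β b) - if a = u ∧ b = v then t else 0)
        (π' := fun a b => if a = u ∧ b = v then t else 0)
      simp only [sub_add_cancel] at e4
      rw [finCost_single hu hv, finCost_add, finCost_smul] at e4
      rw [← e4]
      have : r * finCost c S (fun a b => α a * β b) ≤ 0 :=
        mul_nonpos_of_nonneg_of_nonpos hr0.le key
      linarith

/-- Mass common to both marginals may be cancelled without increasing the cost. -/
lemma FinPlan.exists_cancel {T : Finset V} {t : ℝ} (hT : T ⊆ S) (ht : 0 ≤ t)
    (hμ : ∀ a, 0 ≤ μ a) (hν : ∀ a, 0 ≤ ν a)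
    (hc0 : ∀ a, c a a = 0) (hc : ∀ a b d, c a b ≤ c a d + c d b)
    (h : FinPlan S (fun a => μ a + if a ∈ T then t else 0)
      (fun b => ν b + if b ∈ T then t else 0) π) :
    ∃ π', FinPlan S μ ν π' ∧ finCost c S π' ≤ finCost c S π := by
  induction T using Finset.induction_on generalizing π with
  | empty => exact ⟨π, by simpa using h, le_rfl⟩
  | insert v T hvT ih =>
    have aux : ∀ (ρ : V → ℝ) (a : V), (ρ a + if a ∈ insert v T then t else 0)
        = (ρ a + if a ∈ T then t else 0) + if a = v then t else 0 := by
      intro ρ a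
      by_cases hav : a = v
      · subst hav; simp [hvT]
      · simp [hav]
    have hvS : v ∈ S := hT (Finset.mem_insert_self v T)
    have hnn : ∀ (ρ : V → ℝ), (∀ a, 0 ≤ ρ a) → ∀ a, 0 ≤ ρ a + if a ∈ T then t else 0 :=
      fun ρ hρ a => add_nonneg (hρ a) (by split_ifs <;> simp [ht])
    -- For `u = v` the exchange condition is the triangle inequality through `v`.
    obtain ⟨π₁, h₁, hc₁⟩ := FinPlan.exists_peel (c := c) (t := t)
      (μ := fun a => μ a + if a ∈ T then t else 0) (ν := fun a => ν a + if a ∈ T then t else 0)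
      hvS hvS (h.congr (aux μ) (aux ν)) (hnn μ hμ v) (hnn ν hν v)
      (fun a b _ _ _ _ => by rw [hc0 v, add_zero]; exact hc a b v)
    obtain ⟨π₂, h₂, hc₂⟩ := ih ((Finset.subset_insert v T).trans hT) h₁
    rw [hc0 v, zero_mul, add_zero] at hc₁
    exact ⟨π₂, h₂, hc₂.trans hc₁⟩

end FinPlan

/-! ### Reduction of the Wasserstein distance to finite plans -/

section Wasserstein

open scoped Classical

variable {V : Type*} {S : Finset V} {μ ν : V → ℝ} {π : V → V → ℝ}

lemma FinPlan.isTransportPlan (h : FinPlan S μ ν π) : IsTransportPlan μ ν π where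
  nonneg := h.nonneg
  hasSum_left x := by
    rw [← h.row x]
    exact hasSum_sum_of_ne_finset_zero fun b hb => h.off_right x b hb
  hasSum_right y := by
    rw [← h.col y]
    exact hasSum_sum_of_ne_finset_zero fun a ha => h.off_left a y ha

lemma IsTransportPlan.finPlan (h : IsTransportPlan μ ν π) (hμ : ∀ a, a ∉ S → μ a = 0)
    (hν : ∀ a, a ∉ S → ν a = 0) : FinPlan S μ ν π := by
  have hl : ∀ a b, a ∉ S → π a b = 0 := fun a b ha =>
    le_antisymm (hμ a ha ▸ le_hasSum (h.hasSum_left a) b fun _ _ => h.nonneg _ _) (h.nonneg a b)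
  have hr : ∀ a b, b ∉ S → π a b = 0 := fun a b hb =>
    le_antisymm (hν b hb ▸ le_hasSum (h.hasSum_right b) a fun _ _ => h.nonneg _ _) (h.nonneg a b)
  exact ⟨h.nonneg, hl, hr,
    fun a => (hasSum_sum_of_ne_finset_zero fun b hb => hr a b hb).unique (h.hasSum_left a),
    fun b => (hasSum_sum_of_ne_finset_zero fun a ha => hl a b ha).unique (h.hasSum_right b)⟩

/-- The combinatorial distance as a real cost function. -/
noncomputable def distCost (G : SimpleGraph V) (a b : V) : ℝ := G.dist a b

lemma FinPlan.finCost_nonneg (h : FinPlan S μ ν π) (G : SimpleGraph V) :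
    0 ≤ finCost (distCost G) S π :=
  Finset.sum_nonneg fun a _ => Finset.sum_nonneg fun b _ =>
    mul_nonneg (Nat.cast_nonneg _) (h.nonneg a b)

lemma FinPlan.transportCost_eq (h : FinPlan S μ ν π) (G : SimpleGraph V) :
    transportCost G π = ENNReal.ofReal (finCost (distCost G) S π) := by
  have hnn : ∀ a b, 0 ≤ distCost G a b * π a b := fun a b =>
    mul_nonneg (Nat.cast_nonneg _) (h.nonneg a b)
  rw [finCost, Finset.sum_comm,
    ENNReal.ofReal_sum_of_nonneg fun b _ => Finset.sum_nonneg fun a _ => hnn a b,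
    transportCost, tsum_eq_sum (s := S)]
  · refine Finset.sum_congr rfl fun b _ => ?_
    rw [ENNReal.ofReal_sum_of_nonneg fun a _ => hnn a b, tsum_eq_sum (s := S)]
    · rfl
    · intro a ha
      simp [h.off_left a b ha]
  · intro b hb
    simp [h.off_right _ b hb]

lemma FinPlan.wasserstein_le (h : FinPlan S μ ν π) (G : SimpleGraph V) :
    wasserstein G μ ν ≤ ENNReal.ofReal (finCost (distCost G) S π) := by
  rw [← h.transportCost_eq G]
  exact iInf₂_le π h.isTransportPlan

lemma FinPlan.wasserstein_ne_top (h : FinPlan S μ ν π) (G : SimpleGraph V) :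
    wasserstein G μ ν ≠ ⊤ :=
  ((h.wasserstein_le G).trans_lt ENNReal.ofReal_lt_top).ne

lemma FinPlan.wasserstein_toReal_le (h : FinPlan S μ ν π) (G : SimpleGraph V) :
    (wasserstein G μ ν).toReal ≤ finCost (distCost G) S π :=
  ENNReal.toReal_le_of_le_ofReal (h.finCost_nonneg G) (h.wasserstein_le G)

/-- The given plan serves only to show that the marginals vanish off `S` and that the distance is
finite; every competing plan then lives on `S × S` as well. Working with strict bounds avoids the
existence of optimal plans. -/
lemma FinPlan.exists_finCost_lt (h : FinPlan S μ ν π) (G : SimpleGraph V) {r : ℝ}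
    (hr : (wasserstein G μ ν).toReal < r) :
    ∃ π', FinPlan S μ ν π' ∧ finCost (distCost G) S π' < r := by
  have hlt : wasserstein G μ ν < ENNReal.ofReal r :=
    (ENNReal.lt_ofReal_iff_toReal_lt (h.wasserstein_ne_top G)).2 hr
  simp only [wasserstein, iInf_lt_iff] at hlt
  obtain ⟨π', hp, hlt⟩ := hlt
  have hf : FinPlan S μ ν π' := hp.finPlan
    (fun a ha => by rw [← h.row a]; exact Finset.sum_eq_zero fun b _ => h.off_left a b ha)
    (fun b hb => by rw [← h.col b]; exact Finset.sum_eq_zero fun a _ => h.off_right a b hb)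
  rw [hf.transportCost_eq G] at hlt
  exact ⟨π', hf, (ENNReal.ofReal_lt_ofReal_iff_of_nonneg (hf.finCost_nonneg G)).1 hlt⟩

lemma wasserstein_toReal_le_of_forall_lt (G : SimpleGraph V) {r : ℝ}
    (h : ∀ ε > 0, ∃ S : Finset V, ∃ π, FinPlan S μ ν π ∧ finCost (distCost G) S π ≤ r + ε) :
    (wasserstein G μ ν).toReal ≤ r :=
  le_of_forall_pos_le_add fun ε hε => by
    obtain ⟨S, π, hπ, hc⟩ := h ε hε
    exact (hπ.wasserstein_toReal_le G).trans hc

end Wasserstein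

/-! ### Dependence of the curvature on the idleness -/

section LazyMeasure

open scoped Classical

variable {V : Type*} (G : SimpleGraph V) [G.LocallyFinite]

/-- The union of the two closed neighborhoods of `x` and `y`. -/
noncomputable def edgeSupport (x y : V) : Finset V :=
  insert x (G.neighborFinset x) ∪ insert y (G.neighborFinset y)

lemma mem_edgeSupport {x y z : V} :
    z ∈ edgeSupport G x y ↔ (z = x ∨ G.Adj x z) ∨ (z = y ∨ G.Adj y z) := by
  simp only [edgeSupport, Finset.mem_union, Finset.mem_insert, SimpleGraph.mem_neighborFinset]

lemma lazyMeasure_nonneg {p : ℝ} (h0 : 0 ≤ p) (h1 : p ≤ 1) (x z : V) :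
    0 ≤ lazyMeasure G p x z := by
  rw [lazyMeasure]
  split_ifs
  · exact h0
  · exact div_nonneg (by linarith) (Nat.cast_nonneg _)
  · exact le_rfl

lemma lazyMeasure_eq_zero {p : ℝ} {x z : V} (h : ¬ (z = x ∨ G.Adj x z)) :
    lazyMeasure G p x z = 0 := by
  push Not at h
  simp [lazyMeasure, h.1, h.2]

lemma sum_lazyMeasure (p : ℝ) {x : V} (hx : 0 < G.degree x) {S : Finset V}
    (hS : insert x (G.neighborFinset x) ⊆ S) : ∑ z ∈ S, lazyMeasure G p x z = 1 := by
  rw [← Finset.sum_subset hS fun z _ hz => lazyMeasure_eq_zero G (by simpa using hz),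
    Finset.sum_insert (by simp)]
  have : ∀ z ∈ G.neighborFinset x, lazyMeasure G p x z = (1 - p) / G.degree x := by
    intro z hz
    rw [SimpleGraph.mem_neighborFinset] at hz
    simp [lazyMeasure, hz, hz.ne']
  rw [Finset.sum_congr rfl this, Finset.sum_const, SimpleGraph.card_neighborFinset_eq_degree,
    nsmul_eq_mul]
  have : (G.degree x : ℝ) ≠ 0 := by exact_mod_cast hx.ne'
  simp only [lazyMeasure, if_true]
  field_simp
  ring

variable {G} {x y : V}

lemma degree_pos_of_adj (h : G.Adj x y) : 0 < G.degree x :=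
  (G.degree_pos_iff_exists_adj x).2 ⟨y, h⟩

lemma exists_finPlan_lazyMeasure (h : G.Adj x y) {p : ℝ} (h0 : 0 ≤ p) (h1 : p ≤ 1) :
    ∃ π, FinPlan (edgeSupport G x y) (lazyMeasure G p x) (lazyMeasure G p y) π :=
  ⟨_, finPlan_prod (lazyMeasure_nonneg G h0 h1 x) (lazyMeasure_nonneg G h0 h1 y)
    (fun _ ha => lazyMeasure_eq_zero G fun h => ha ((mem_edgeSupport G).2 (Or.inl h)))
    (fun _ ha => lazyMeasure_eq_zero G fun h => ha ((mem_edgeSupport G).2 (Or.inr h)))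
    (sum_lazyMeasure G p (degree_pos_of_adj h) Finset.subset_union_left)
    (sum_lazyMeasure G p (degree_pos_of_adj h.symm) Finset.subset_union_right)⟩

lemma exists_finCost_lt_of_kappa (h : G.Adj x y) {p r : ℝ} (h0 : 0 ≤ p) (h1 : p ≤ 1)
    (hr : 1 - kappa G p x y < r) :
    ∃ π, FinPlan (edgeSupport G x y) (lazyMeasure G p x) (lazyMeasure G p y) π ∧
      finCost (distCost G) (edgeSupport G x y) π < r := by
  obtain ⟨π, hπ⟩ := exists_finPlan_lazyMeasure h h0 h1
  refine hπ.exists_finCost_lt G ?_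
  rw [kappa] at hr
  linarith

/-- `p ↦ κ_p` is concave along the segment from `p` to `1`. -/
lemma mul_kappa_le_kappa (h : G.Adj x y) {p t : ℝ} (h0 : 0 ≤ p) (h1 : p ≤ 1) (ht0 : 0 ≤ t)
    (ht1 : t ≤ 1) : t * kappa G p x y ≤ kappa G (t * p + (1 - t)) x y := by
  have hW : (wasserstein G (lazyMeasure G (t * p + (1 - t)) x)
      (lazyMeasure G (t * p + (1 - t)) y)).toReal ≤ 1 - t * kappa G p x y := by
    refine wasserstein_toReal_le_of_forall_lt G fun ε hε => ?_
    obtain ⟨π, hπ, hc⟩ := exists_finCost_lt_of_kappa h h0 h1 (lt_add_of_pos_right _ hε)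
    have hx : x ∈ edgeSupport G x y := (mem_edgeSupport G).2 (Or.inl (Or.inl rfl))
    have hy : y ∈ edgeSupport G x y := (mem_edgeSupport G).2 (Or.inr (Or.inl rfl))
    -- Raising the idleness mixes in Dirac masses at the two ends, which travel along the edge at
    -- cost `1 - t`.
    have key : ∀ w z, t * lazyMeasure G p w z + (if z = w then 1 - t else 0)
        = lazyMeasure G (t * p + (1 - t)) w z := by
      intro w z
      simp only [lazyMeasure]
      split_ifs
      · ring
      · ring
      · ring
    refine ⟨_, _, ((hπ.smul ht0).add (finPlan_single hx hy (sub_nonneg.2 ht1))).congr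
      (key x) (key y), ?_⟩
    rw [finCost_add, finCost_smul, finCost_single hx hy]
    have hd : distCost G x y = 1 := by
      rw [distCost, SimpleGraph.dist_eq_one_iff_adj.2 h, Nat.cast_one]
    rw [hd]
    have : t * finCost (distCost G) (edgeSupport G x y) π ≤ t * (1 - kappa G p x y + ε) :=
      mul_le_mul_of_nonneg_left hc.le ht0
    have : t * ε ≤ ε := mul_le_of_le_one_left hε.le ht1
    linarith
  rw [kappa.eq_def _ (t * p + (1 - t))]
  linarith

lemma kappa_div_mono (h : G.Adj x y) {p q : ℝ} (h0 : 0 ≤ p) (hpq : p ≤ q) (hq : q < 1) :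
    kappa G p x y / (1 - p) ≤ kappa G q x y / (1 - q) := by
  have hp : 0 < 1 - p := by linarith
  have hq' : 0 < 1 - q := by linarith
  have := mul_kappa_le_kappa h (t := (1 - q) / (1 - p)) h0 (by linarith)
    (div_nonneg hq'.le hp.le) ((div_le_one hp).2 (by linarith))
  have e : (1 - q) / (1 - p) * p + (1 - (1 - q) / (1 - p)) = q := by
    field_simp
    ring
  rw [e] at this
  rw [le_div_iff₀ hq']
  calc _ = (1 - q) / (1 - p) * kappa G p x y := by ring
    _ ≤ _ := this

/-- Of the mass `p` at `x`, at most `1 - p` can stay, since the target measure has no more there;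
the remaining `2 * p - 1` moves a distance of at least one. -/
lemma kappa_le (h : G.Adj x y) {p : ℝ} (h0 : 0 ≤ p) (h1 : p ≤ 1) :
    kappa G p x y ≤ 2 * (1 - p) := by
  by_contra! hlt
  obtain ⟨π, hπ, hc⟩ := exists_finCost_lt_of_kappa h h0 h1 (r := 2 * p - 1) (by linarith)
  have hx : x ∈ edgeSupport G x y := (mem_edgeSupport G).2 (Or.inl (Or.inl rfl))
  have hrow := hπ.row x
  rw [← Finset.add_sum_erase _ _ hx] at hrow
  have hxx : π x x ≤ 1 - p := by
    refine (hπ.le_right x x).trans ?_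
    have : (1 : ℝ) ≤ G.degree y := by exact_mod_cast degree_pos_of_adj h.symm
    rw [lazyMeasure, if_neg h.ne, if_pos h.symm]
    exact div_le_self (by linarith) this
  have hp : lazyMeasure G p x x = p := by simp [lazyMeasure]
  have : ∑ b ∈ (edgeSupport G x y).erase x, π x b
      ≤ finCost (distCost G) (edgeSupport G x y) π := by
    calc _ ≤ ∑ b ∈ (edgeSupport G x y).erase x, distCost G x b * π x b := by
          refine Finset.sum_le_sum fun b hb => le_mul_of_one_le_left (hπ.nonneg x b) ?_
          rw [Finset.mem_erase, mem_edgeSupport] at hb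
          -- `SimpleGraph.dist` is `0` between unreachable vertices, so the lower bound on the
          -- distance needs reachability.
          have hr : G.Reachable x b := by
            rcases hb.2 with (e | e) | (e | e)
            · rw [e]
            · exact e.reachable
            · exact e ▸ h.reachable
            · exact h.reachable.trans e.reachable
          exact Nat.one_le_cast.2 <| hr.pos_dist_of_ne hb.1.symm
      _ ≤ ∑ b ∈ edgeSupport G x y, distCost G x b * π x b :=
          Finset.sum_le_sum_of_subset_of_nonneg (Finset.erase_subset _ _) fun b _ _ =>
            mul_nonneg (Nat.cast_nonneg _) (hπ.nonneg x b)
      _ ≤ _ := Finset.single_le_sum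
          (f := fun a => ∑ b ∈ edgeSupport G x y, distCost G a b * π a b)
          (fun a _ => Finset.sum_nonneg fun b _ =>
            mul_nonneg (Nat.cast_nonneg _) (hπ.nonneg a b)) hx
  linarith

/-- On every edge, the limit defining the Lin-Lu-Yau curvature exists. -/
lemma hasKappaLLY_of_adj (h : G.Adj x y) : HasKappaLLY G x y := by
  refine tendsto_nhds_limUnder ⟨sSup ((fun p => kappa G p x y / (1 - p)) '' Set.Ico 0 1), ?_⟩
  have hbdd : BddAbove ((fun p => kappa G p x y / (1 - p)) '' Set.Ico 0 1) := by
    refine ⟨2, ?_⟩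
    rintro _ ⟨p, hp, rfl⟩
    have : 0 < 1 - p := by linarith [hp.2]
    exact (div_le_iff₀ this).2 (kappa_le h hp.1 hp.2.le)
  rw [tendsto_order]
  refine ⟨fun a ha => ?_, fun a ha => ?_⟩
  · obtain ⟨_, ⟨p, hp, rfl⟩, hlt⟩ := exists_lt_of_lt_csSup
      ((Set.nonempty_Ico.2 zero_lt_one).image _) ha
    filter_upwards [Ioo_mem_nhdsLT hp.2] with q hq
    exact hlt.trans_le (kappa_div_mono h hp.1 hq.1.le hq.2)
  · filter_upwards [Ioo_mem_nhdsLT (zero_lt_one (α := ℝ))] with q hq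
    exact (le_csSup hbdd ⟨q, ⟨hq.1.le, hq.2⟩, rfl⟩).trans_lt ha

/-- By monotonicity of the quotient, one idleness below `1` is enough. -/
lemma kappaLLY_nonneg_of_kappa (h : G.Adj x y) {p : ℝ} (h0 : 0 ≤ p) (h1 : p < 1)
    (hk : 0 ≤ kappa G p x y) : 0 ≤ kappaLLY G x y := by
  refine ge_of_tendsto (hasKappaLLY_of_adj h) ?_
  filter_upwards [Ioo_mem_nhdsLT h1] with q hq
  exact (div_nonneg hk (by linarith)).trans (kappa_div_mono h h0 hq.1.le hq.2)

lemma exists_kappa_ge_of_kappaLLY_nonneg (h : G.Adj x y) (hk : 0 ≤ kappaLLY G x y) {ε q : ℝ}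
    (hε : 0 < ε) (hq : q < 1) : ∃ p, q < p ∧ p < 1 ∧ -ε * (1 - p) ≤ kappa G p x y := by
  have h1 := (hasKappaLLY_of_adj h).eventually (lt_mem_nhds (show -ε < kappaLLY G x y by linarith))
  obtain ⟨p, hp, hqp⟩ := (h1.and (Ioo_mem_nhdsLT hq)).exists
  exact ⟨p, hqp.1, hqp.2, ((lt_div_iff₀ (by linarith [hqp.2])).1 hp).le⟩

end LazyMeasure

/-! ### Plans between neighborhoods in a regular graph -/

section Regular

open scoped Classical

variable {V : Type*} (G : SimpleGraph V)

/-- The indicator function of the neighborhood of `x`. -/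
noncomputable def openInd (x z : V) : ℝ := if G.Adj x z then 1 else 0

/-- The indicator function of the closed neighborhood of `x`. -/
noncomputable def closedInd (x z : V) : ℝ := if z = x ∨ G.Adj x z then 1 else 0

lemma closedInd_eq (x z : V) : (if z = x then 1 else 0) + openInd G x z = closedInd G x z := by
  by_cases h : z = x
  · subst h; simp [openInd, closedInd]
  · simp [openInd, closedInd, h]

variable [G.LocallyFinite]

lemma lazyMeasure_eq (p : ℝ) (x z : V) : lazyMeasure G p x z =
    (if z = x then p - (1 - p) / G.degree x else 0)
      + (1 - p) / G.degree x * closedInd G x z := by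
  by_cases h : z = x
  · subst h; simp [lazyMeasure, closedInd]
  · simp [lazyMeasure, closedInd, h]

variable {G} {x y : V}

/-- In the transport between two closed neighborhoods of adjacent vertices `x` and `y`, an excess
mass at `x` and `y` may be assumed to move along the edge. -/
lemma exists_finPlan_closedInd (hG : G.Connected) (h : G.Adj x y) {m s : ℝ}
    (hs : 0 ≤ s) {π : V → V → ℝ}
    (hπ : FinPlan (edgeSupport G x y) (fun a => (if a = x then m else 0) + s * closedInd G x a)
      (fun a => (if a = y then m else 0) + s * closedInd G y a) π) (hm : 0 ≤ m) :
    ∃ π', FinPlan (edgeSupport G x y) (fun a => s * closedInd G x a)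
        (fun a => s * closedInd G y a) π' ∧
      finCost (distCost G) (edgeSupport G x y) π' + m
        ≤ finCost (distCost G) (edgeSupport G x y) π := by
  have hx : x ∈ edgeSupport G x y := (mem_edgeSupport G).2 (Or.inl (Or.inl rfl))
  have hy : y ∈ edgeSupport G x y := (mem_edgeSupport G).2 (Or.inr (Or.inl rfl))
  have hd : distCost G x y = 1 := by
    rw [distCost, SimpleGraph.dist_eq_one_iff_adj.2 h, Nat.cast_one]
  have hc0 : ∀ a, distCost G a a = 0 := fun a => by simp [distCost]
  have htri : ∀ a b d, distCost G a b ≤ distCost G a d + distCost G d b := fun a b d => by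
    simp only [distCost]
    exact_mod_cast hG.dist_triangle
  have hle1 : ∀ {u a}, (a = u ∨ G.Adj u a) → distCost G u a ≤ 1 := by
    rintro u a (rfl | e)
    · simp [hc0]
    · rw [distCost, SimpleGraph.dist_eq_one_iff_adj.2 e, Nat.cast_one]
  have hge2 : ∀ {u a}, ¬ (a = u ∨ G.Adj u a) → 2 ≤ distCost G u a := by
    intro u a hn
    push Not at hn
    have h1 := (hG.preconnected u a).pos_dist_of_ne hn.1.symm
    have h2 : G.dist u a ≠ 1 := fun e => hn.2 (SimpleGraph.dist_eq_one_iff_adj.1 e)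
    have h3 : 2 ≤ G.dist u a := by omega
    rw [distCost]
    exact_mod_cast h3
  have hsymm : ∀ a b, distCost G a b = distCost G b a := fun a b => by
    rw [distCost, distCost, SimpleGraph.dist_comm]
  -- The mass on the common part `T` of the closed neighborhoods is cancelled first and put back at
  -- the end, where it stays in place for free.
  obtain ⟨T, hT⟩ : ∃ T : Finset V, T = (edgeSupport G x y).filter
    fun z => (z = x ∨ G.Adj x z) ∧ (z = y ∨ G.Adj y z) := ⟨_, rfl⟩
  have hTS : T ⊆ edgeSupport G x y := hT ▸ Finset.filter_subset _ _
  have memT : ∀ z, z ∈ T ↔ (z = x ∨ G.Adj x z) ∧ (z = y ∨ G.Adj y z) := fun z => by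
    rw [hT, Finset.mem_filter, mem_edgeSupport]
    tauto
  obtain ⟨A, hA⟩ : ∃ A : V → V → V → ℝ, A = fun u v z =>
    if (z = u ∨ G.Adj u z) ∧ ¬ (z = v ∨ G.Adj v z) then s else 0 := ⟨_, rfl⟩
  have hA0 : ∀ u v z, 0 ≤ A u v z := fun u v z => by
    rw [hA]
    dsimp only
    split_ifs <;> simp [hs]
  have hApos : ∀ u v z, 0 < A u v z → (z = u ∨ G.Adj u z) ∧ ¬ (z = v ∨ G.Adj v z) := by
    intro u v z hz
    by_contra hn
    rw [hA] at hz
    simp only [if_neg hn, lt_irrefl] at hz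
  have hsplit1 : ∀ z, A x y z + (if z ∈ T then s else 0) = s * closedInd G x z := fun z => by
    rw [hA, closedInd]
    simp only [memT]
    by_cases h1 : z = x ∨ G.Adj x z <;> by_cases h2 : z = y ∨ G.Adj y z <;> simp [h1, h2]
  have hsplit2 : ∀ z, A y x z + (if z ∈ T then s else 0) = s * closedInd G y z := fun z => by
    rw [hA, closedInd]
    simp only [memT]
    by_cases h1 : z = x ∨ G.Adj x z <;> by_cases h2 : z = y ∨ G.Adj y z <;> simp [h1, h2]
  have hδ : ∀ u z : V, 0 ≤ if z = u then m else 0 := fun u z => by split_ifs <;> simp [hm]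
  obtain ⟨π₁, h₁, hc₁⟩ := FinPlan.exists_cancel (c := distCost G) (T := T) (t := s)
    (μ := fun a => A x y a + if a = x then m else 0)
    (ν := fun a => A y x a + if a = y then m else 0) hTS hs
    (fun a => add_nonneg (hA0 _ _ _) (hδ _ _)) (fun a => add_nonneg (hA0 _ _ _) (hδ _ _)) hc0 htri
    (hπ.congr (fun a => by rw [← hsplit1]; ring) (fun a => by rw [← hsplit2]; ring))
  -- The remaining sources `a` are adjacent to `x` but at distance at least `2` from `y`. Hence the
  -- detour `d(a, b) ≤ 1 + d(x, b)` gives `d(a, b) + 1 ≤ d(a, y) + d(x, b)`.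
  obtain ⟨π₂, h₂, hc₂⟩ := FinPlan.exists_peel (c := distCost G) hx hy h₁ (hA0 _ _ _) (hA0 _ _ _)
    (fun a b _ ha _ hb => by
      have ha' := hApos _ _ _ ha
      have hb' := hApos _ _ _ hb
      have e1 := hge2 ha'.2
      have e2 := hge2 hb'.2
      have e3 := hle1 ha'.1
      have e4 := hle1 hb'.1
      rw [hsymm] at e1 e3
      have e5 := htri a b x
      have e6 := htri x b y
      linarith)
  refine ⟨_, (h₂.add (finPlan_diag hTS hs)).congr hsplit1 hsplit2, ?_⟩
  rw [finCost_add, finCost_diag hc0]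
  rw [hd, one_mul] at hc₂
  linarith

lemma exists_finPlan_closedInd_of_kappaLLY (hG : G.Connected) {D : ℕ}
    (hD : G.IsRegularOfDegree D) (h : G.Adj x y) (hk : 0 ≤ kappaLLY G x y) {ε : ℝ} (hε : 0 < ε) :
    ∃ π, FinPlan (edgeSupport G x y) (closedInd G x) (closedInd G y) π ∧
      finCost (distCost G) (edgeSupport G x y) π ≤ D + 1 + ε := by
  have hD0 : (0 : ℝ) < D := by
    rw [← hD x]
    exact_mod_cast degree_pos_of_adj h
  -- The bound `p > 1 / (D + 1)` makes the excess `p - (1 - p) / D` positive. Halving the error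
  -- leaves room for a strict inequality.
  obtain ⟨p, hqp, hp1, hp⟩ := exists_kappa_ge_of_kappaLLY_nonneg h hk (ε := ε / (2 * D))
    (q := 1 / (D + 1)) (by positivity) ((div_lt_one (by positivity)).2 (by linarith))
  have hp0 : 0 < p := lt_trans (by positivity) hqp
  obtain ⟨s, hs⟩ : ∃ s : ℝ, s = (1 - p) / D := ⟨_, rfl⟩
  have hsD : s * D = 1 - p := by rw [hs]; field_simp
  have hs0 : 0 < s := by rw [hs]; exact div_pos (by linarith) hD0
  have hm : 0 ≤ p - s := by
    rw [div_lt_iff₀ (by positivity)] at hqp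
    rw [sub_nonneg, hs, div_le_iff₀ hD0]
    linarith
  obtain ⟨π, hπ, hc⟩ := exists_finCost_lt_of_kappa h hp0.le hp1.le
    (r := 1 + ε / D * (1 - p)) (by
      have : ε / D * (1 - p) = 2 * (ε / (2 * D) * (1 - p)) := by field_simp
      have : 0 < ε / (2 * D) * (1 - p) := mul_pos (by positivity) (by linarith)
      linarith)
  obtain ⟨π', hπ', hc'⟩ := exists_finPlan_closedInd hG h (m := p - s) (s := s) hs0.le
    (hπ.congr (fun a => by rw [lazyMeasure_eq, hD x, hs]) (fun a => by rw [lazyMeasure_eq, hD y, hs]))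
    hm
  refine ⟨_, (hπ'.smul (inv_nonneg.2 hs0.le)).congr
    (fun a => by rw [← mul_assoc, inv_mul_cancel₀ hs0.ne', one_mul])
    (fun a => by rw [← mul_assoc, inv_mul_cancel₀ hs0.ne', one_mul]), ?_⟩
  rw [finCost_smul, inv_mul_le_iff₀ hs0]
  have : ε / D * (1 - p) = s * ε := by rw [← hsD]; field_simp
  nlinarith

lemma exists_finPlan_openInd_of_kappa {D : ℕ} (hD : G.IsRegularOfDegree D) (h : G.Adj x y)
    (hk : 0 ≤ kappa G 0 x y) {ε : ℝ} (hε : 0 < ε) :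
    ∃ π, FinPlan (edgeSupport G x y) (openInd G x) (openInd G y) π ∧
      finCost (distCost G) (edgeSupport G x y) π ≤ D + ε := by
  have hD0 : (0 : ℝ) < D := by
    rw [← hD x]
    exact_mod_cast degree_pos_of_adj h
  obtain ⟨π, hπ, hc⟩ := exists_finCost_lt_of_kappa h le_rfl zero_le_one
    (r := 1 + ε / D) (by have : 0 < ε / D := by positivity
                         linarith)
  have key : ∀ w z, (D : ℝ) * lazyMeasure G 0 w z = openInd G w z := by
    intro w z
    by_cases hz : z = w
    · subst hz; simp [lazyMeasure, openInd]
    · by_cases hw : G.Adj w z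
      · simp [lazyMeasure, openInd, hz, hw, hD w, hD0.ne']
      · simp [lazyMeasure, openInd, hz, hw]
  refine ⟨_, (hπ.smul hD0.le).congr (key x) (key y), ?_⟩
  rw [finCost_smul]
  calc (D : ℝ) * finCost (distCost G) (edgeSupport G x y) π ≤ D * (1 + ε / D) :=
        mul_le_mul_of_nonneg_left hc.le hD0.le
    _ = D + ε := by field_simp

lemma FinPlan.closedInd_of_openInd (h : G.Adj x y) {π : V → V → ℝ}
    (hπ : FinPlan (edgeSupport G x y) (openInd G x) (openInd G y) π) :
    ∃ π', FinPlan (edgeSupport G x y) (closedInd G x) (closedInd G y) π' ∧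
      finCost (distCost G) (edgeSupport G x y) π'
        = 1 + finCost (distCost G) (edgeSupport G x y) π := by
  have hx : x ∈ edgeSupport G x y := (mem_edgeSupport G).2 (Or.inl (Or.inl rfl))
  have hy : y ∈ edgeSupport G x y := (mem_edgeSupport G).2 (Or.inr (Or.inl rfl))
  refine ⟨_, ((finPlan_single hx hy zero_le_one).add hπ).congr (closedInd_eq G x)
    (closedInd_eq G y), ?_⟩
  rw [finCost_add, finCost_single hx hy, distCost, SimpleGraph.dist_eq_one_iff_adj.2 h]
  simp

end Regular

/-! ### Layerwise transport in the strong product -/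

section StrongProduct

open scoped Classical

variable {V : Type*} {W : Type*} {G : SimpleGraph V} {H : SimpleGraph W}

/-- A geodesic of `G` lifts to the layer over `y`; connectedness of `G` provides the geodesic. -/
lemma distCost_strongProd_le (hG : G.Connected) (a b : V) (y : W) :
    distCost (strongProd G H) (a, y) (b, y) ≤ distCost G a b := by
  obtain ⟨w, hw⟩ := hG.exists_walk_length_eq_dist a b
  let f : G →g strongProd G H := ⟨fun v => (v, y), fun h => Or.inl ⟨h, rfl⟩⟩
  have := SimpleGraph.dist_le (w.map f)
  rw [SimpleGraph.Walk.length_map, hw] at this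
  exact Nat.cast_le.2 this

/-- Transport plans in the layers of a product combine to a transport plan in the product. -/
lemma FinPlan.layers {S : Finset V} {T : Finset W} {μ ν : W → V → ℝ} {ρ : W → V → V → ℝ}
    (h : ∀ y ∈ T, FinPlan S (μ y) (ν y) (ρ y)) :
    FinPlan (S ×ˢ T) (fun a => if a.2 ∈ T then μ a.2 a.1 else 0)
      (fun a => if a.2 ∈ T then ν a.2 a.1 else 0)
      (fun a b => if a.2 = b.2 ∧ a.2 ∈ T then ρ a.2 a.1 b.1 else 0) where
  nonneg a b := by
    split_ifs with hab
    · exact (h _ hab.2).nonneg _ _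
    · exact le_rfl
  off_left a b ha := by
    split_ifs with hab
    · exact (h _ hab.2).off_left _ _ fun h' => ha (Finset.mem_product.2 ⟨h', hab.2⟩)
    · rfl
  off_right a b hb := by
    split_ifs with hab
    · exact (h _ hab.2).off_right _ _ fun h' => hb (Finset.mem_product.2 ⟨h', hab.1 ▸ hab.2⟩)
    · rfl
  row a := by
    rw [Finset.sum_product]
    split_ifs with ha
    · rw [← (h _ ha).row]
      refine Finset.sum_congr rfl fun b _ => ?_
      simp [ha]
    · simp [ha]
  col b := by
    rw [Finset.sum_product]
    split_ifs with hb
    · rw [← (h _ hb).col]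
      refine Finset.sum_congr rfl fun a _ => ?_
      rw [Finset.sum_eq_single_of_mem b.2 hb]
      · simp [hb]
      · intro c _ hc
        simp [hc]
    · refine Finset.sum_eq_zero fun a _ => Finset.sum_eq_zero fun c _ => if_neg ?_
      rintro ⟨e, hc⟩
      exact hb (e ▸ hc)

lemma finCost_layers_le (hG : G.Connected) {S : Finset V} {T : Finset W} {ρ : W → V → V → ℝ}
    (hρ : ∀ y ∈ T, ∀ a b, 0 ≤ ρ y a b) :
    finCost (distCost (strongProd G H)) (S ×ˢ T)
      (fun a b => if a.2 = b.2 ∧ a.2 ∈ T then ρ a.2 a.1 b.1 else 0)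
      ≤ ∑ y ∈ T, finCost (distCost G) S (ρ y) := by
  simp only [finCost]
  rw [Finset.sum_product_right]
  refine Finset.sum_le_sum fun y hy => Finset.sum_le_sum fun a _ => ?_
  rw [Finset.sum_product]
  refine Finset.sum_le_sum fun b _ => ?_
  rw [Finset.sum_eq_single_of_mem y hy]
  · simp only [hy, and_self, if_true]
    exact mul_le_mul_of_nonneg_right (distCost_strongProd_le hG a b y) (hρ y hy a b)
  · intro c _ hc
    simp [hc.symm]

lemma strongProd_adj_or_eq (a b : V × W) : (b = a ∨ (strongProd G H).Adj a b) ↔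
    (b.1 = a.1 ∨ G.Adj a.1 b.1) ∧ (b.2 = a.2 ∨ H.Adj a.2 b.2) := by
  rw [Prod.ext_iff]
  simp only [strongProd, eq_comm (a := b.1), eq_comm (a := b.2)]
  tauto

variable [G.LocallyFinite] [H.LocallyFinite]

/-- Closed neighborhoods in the strong product are products of closed neighborhoods. -/
lemma degree_strongProd (x : V) (y : W) :
    (strongProd G H).degree (x, y) + 1 = (G.degree x + 1) * (H.degree y + 1) := by
  have e : insert (x, y) ((strongProd G H).neighborFinset (x, y))
      = insert x (G.neighborFinset x) ×ˢ insert y (H.neighborFinset y) := by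
    ext b
    simpa only [Finset.mem_insert, SimpleGraph.mem_neighborFinset, Finset.mem_product]
      using strongProd_adj_or_eq (x, y) b
  have := congrArg Finset.card e
  rwa [Finset.card_product, Finset.card_insert_of_notMem (by simp),
    Finset.card_insert_of_notMem (by simp), Finset.card_insert_of_notMem (by simp),
    SimpleGraph.card_neighborFinset_eq_degree, SimpleGraph.card_neighborFinset_eq_degree,
    SimpleGraph.card_neighborFinset_eq_degree] at this

variable {x₁ x₂ : V}

lemma kappa_zero_horizontal_nonneg (hG : G.Connected) {D : ℕ} (hD : G.IsRegularOfDegree D)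
    (h : G.Adj x₁ x₂) (hk : 0 ≤ kappa G 0 x₁ x₂) (y : W) :
    0 ≤ kappa (strongProd G H) 0 (x₁, y) (x₂, y) := by
  have hdeg : ∀ x, ((strongProd G H).degree (x, y) : ℝ) + 1 = (D + 1) * (H.degree y + 1) :=
    fun x => by rw [← hD x]; exact_mod_cast degree_strongProd x y
  obtain ⟨d, hd⟩ : ∃ d : ℝ, d = (D + 1) * (H.degree y + 1) - 1 := ⟨_, rfl⟩
  have hD1 : (1 : ℝ) ≤ D := by
    rw [← hD x₁]
    exact_mod_cast degree_pos_of_adj h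
  have hE0 : (0 : ℝ) ≤ H.degree y := Nat.cast_nonneg _
  have hd0 : 0 < d := by rw [hd]; nlinarith
  rw [kappa, sub_nonneg]
  refine wasserstein_toReal_le_of_forall_lt _ fun ε hε => ?_
  -- The error `δ` occurs once in each of the `H.degree y + 1` layers, and the total is divided by
  -- the degree `d`.
  obtain ⟨δ, hδ⟩ : ∃ δ : ℝ, δ = ε * d / (H.degree y + 1) := ⟨_, rfl⟩
  have hδ0 : 0 < δ := by rw [hδ]; positivity
  obtain ⟨τ, hτ, hcτ⟩ := exists_finPlan_openInd_of_kappa hD h hk hδ0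
  obtain ⟨σ, hσ, hcσ⟩ := hτ.closedInd_of_openInd h
  obtain ⟨T, hT⟩ : ∃ T : Finset W, T = insert y (H.neighborFinset y) := ⟨_, rfl⟩
  obtain ⟨μ, hμ⟩ : ∃ μ : V → W → V → ℝ,
    μ = fun x z => if z = y then openInd G x else closedInd G x := ⟨_, rfl⟩
  have hplan : ∀ z ∈ T, FinPlan (edgeSupport G x₁ x₂) (μ x₁ z) (μ x₂ z)
      (if z = y then τ else σ) := by
    intro z _
    rw [hμ]
    by_cases hz : z = y
    · simpa [hz] using hτ
    · simpa [hz] using hσ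
  have key : ∀ x (a : V × W), d⁻¹ * (if a.2 ∈ T then μ x a.2 a.1 else 0)
      = lazyMeasure (strongProd G H) 0 (x, y) a := by
    rintro x ⟨a, b⟩
    have hdx : ((strongProd G H).degree (x, y) : ℝ) = d := by linarith [hdeg x]
    rw [hT, hμ, lazyMeasure, hdx]
    simp only [Finset.mem_insert, SimpleGraph.mem_neighborFinset, strongProd, Prod.mk.injEq]
    by_cases hb : b = y
    · subst hb
      by_cases ha : a = x
      · subst ha; simp [openInd]
      · simp [ha, openInd]
    · have hb' : ¬ y = b := fun e => hb e.symm
      by_cases hbb : H.Adj y b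
      · by_cases ha : a = x
        · subst ha; simp [hb, hbb, closedInd]
        · have ha' : ¬ x = a := fun e => ha e.symm
          simp [hb, hb', ha, ha', hbb, closedInd]
      · simp [hb, hb', hbb]
  refine ⟨_, _, ((FinPlan.layers hplan).smul (inv_nonneg.2 hd0.le)).congr (key x₁) (key x₂), ?_⟩
  rw [finCost_smul, inv_mul_le_iff₀ hd0]
  refine (finCost_layers_le hG fun z hz => (hplan z hz).nonneg).trans ?_
  rw [hT, Finset.sum_insert (by simp), if_pos rfl]
  have : ∑ z ∈ H.neighborFinset y, finCost (distCost G) (edgeSupport G x₁ x₂)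
      (if z = y then τ else σ) = H.degree y * finCost (distCost G) (edgeSupport G x₁ x₂) σ := by
    rw [← H.card_neighborFinset_eq_degree, ← nsmul_eq_mul, ← Finset.sum_const]
    refine Finset.sum_congr rfl fun z hz => ?_
    rw [SimpleGraph.mem_neighborFinset] at hz
    rw [if_neg hz.ne']
  rw [this, hcσ]
  have h1 : (H.degree y : ℝ) * (1 + finCost (distCost G) (edgeSupport G x₁ x₂) τ)
      ≤ H.degree y * (1 + (D + δ)) := mul_le_mul_of_nonneg_left (by linarith) hE0
  have h2 : δ * (H.degree y + 1) = ε * d := by rw [hδ]; field_simp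
  nlinarith

lemma kappaLLY_horizontal_nonneg (hG : G.Connected) {D : ℕ} (hD : G.IsRegularOfDegree D)
    (h : G.Adj x₁ x₂) (hk : 0 ≤ kappaLLY G x₁ x₂) (y : W) :
    0 ≤ kappaLLY (strongProd G H) (x₁, y) (x₂, y) := by
  have hdeg : ∀ x, ((strongProd G H).degree (x, y) : ℝ) + 1 = (D + 1) * (H.degree y + 1) :=
    fun x => by rw [← hD x]; exact_mod_cast degree_strongProd x y
  obtain ⟨n, hn⟩ : ∃ n : ℝ, n = (D + 1) * (H.degree y + 1) := ⟨_, rfl⟩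
  have hD1 : (1 : ℝ) ≤ D := by
    rw [← hD x₁]
    exact_mod_cast degree_pos_of_adj h
  have hE0 : (0 : ℝ) ≤ H.degree y := Nat.cast_nonneg _
  have hn1 : 1 < n := by rw [hn]; nlinarith
  have hn0 : 0 < n := by linarith
  -- At idleness `n⁻¹` the excess at the center vanishes and the measure is uniform on the closed
  -- neighborhood.
  refine kappaLLY_nonneg_of_kappa (p := n⁻¹) (Or.inl ⟨h, rfl⟩) (inv_nonneg.2 hn0.le)
    (inv_lt_one_of_one_lt₀ hn1) ?_
  rw [kappa, sub_nonneg]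
  refine wasserstein_toReal_le_of_forall_lt _ fun ε hε => ?_
  have hδ0 : 0 < ε * (D + 1) := by positivity
  obtain ⟨σ, hσ, hcσ⟩ := exists_finPlan_closedInd_of_kappaLLY hG hD h hk hδ0
  obtain ⟨T, hT⟩ : ∃ T : Finset W, T = insert y (H.neighborFinset y) := ⟨_, rfl⟩
  have key : ∀ x (a : V × W), n⁻¹ * (if a.2 ∈ T then closedInd G x a.1 else 0)
      = lazyMeasure (strongProd G H) n⁻¹ (x, y) a := by
    intro x a
    have hdx : ((strongProd G H).degree (x, y) : ℝ) = n - 1 := by linarith [hdeg x]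
    have hn' : n - 1 ≠ 0 := by linarith
    have e : (1 - n⁻¹) / (n - 1) = n⁻¹ := by field_simp
    rw [lazyMeasure_eq, hdx, e, sub_self, hT]
    simp only [ite_self, zero_add, closedInd, strongProd_adj_or_eq, Finset.mem_insert,
      SimpleGraph.mem_neighborFinset]
    by_cases h1 : a.1 = x ∨ G.Adj x a.1 <;> by_cases h2 : a.2 = y ∨ H.Adj y a.2 <;> simp [h1, h2]
  refine ⟨_, _, ((FinPlan.layers (T := T) fun _ _ => hσ).smul (inv_nonneg.2 hn0.le)).congr
    (key x₁) (key x₂), ?_⟩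
  rw [finCost_smul, inv_mul_le_iff₀ hn0]
  refine (finCost_layers_le hG fun z hz => hσ.nonneg).trans ?_
  rw [Finset.sum_const, hT, Finset.card_insert_of_notMem (by simp),
    SimpleGraph.card_neighborFinset_eq_degree, nsmul_eq_mul, Nat.cast_add, Nat.cast_one]
  calc ((H.degree y : ℝ) + 1) * finCost (distCost G) (edgeSupport G x₁ x₂) σ
      ≤ (H.degree y + 1) * (D + 1 + ε * (D + 1)) :=
        mul_le_mul_of_nonneg_left hcσ (by positivity)
    _ = n * (1 + ε) := by rw [hn]; ring

end StrongProduct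

/-! ### Invariance under isomorphism, for the vertical edges -/

section Iso

variable {V : Type*} {V' : Type*} {K : SimpleGraph V} {K' : SimpleGraph V'}

lemma dist_iso (e : K ≃g K') (a b : V) : K'.dist (e a) (e b) = K.dist a b := by
  rw [SimpleGraph.dist_eq_sInf, SimpleGraph.dist_eq_sInf]
  congr 1
  ext n
  constructor
  · rintro ⟨w, rfl⟩
    exact ⟨(w.map e.symm.toHom).copy (e.symm_apply_apply a) (e.symm_apply_apply b), by simp⟩
  · rintro ⟨w, rfl⟩
    exact ⟨w.map e.toHom, by simp⟩

/-- Plans pull back along `e` at equal cost; applying this to `e.symm` as well yields equality. -/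
lemma wasserstein_comp_iso_le (e : K ≃g K') (μ ν : V' → ℝ) :
    wasserstein K (fun a => μ (e a)) (fun a => ν (e a)) ≤ wasserstein K' μ ν := by
  refine le_iInf₂ fun π hπ => ?_
  have h : IsTransportPlan (fun a => μ (e a)) (fun a => ν (e a)) fun a b => π (e a) (e b) :=
    ⟨fun a b => hπ.nonneg _ _,
      fun a => e.toEquiv.hasSum_iff.2 (hπ.hasSum_left (e a)),
      fun b => (e.toEquiv.hasSum_iff (f := fun a => π a (e b))).2 (hπ.hasSum_right (e b))⟩
  refine (iInf₂_le _ h).trans (le_of_eq ?_)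
  rw [transportCost, transportCost, ← e.toEquiv.tsum_eq]
  refine tsum_congr fun b => ?_
  rw [← e.toEquiv.tsum_eq]
  refine tsum_congr fun a => ?_
  rw [← dist_iso e a b]
  rfl

lemma wasserstein_comp_iso (e : K ≃g K') (μ ν : V' → ℝ) :
    wasserstein K (fun a => μ (e a)) (fun a => ν (e a)) = wasserstein K' μ ν := by
  refine le_antisymm (wasserstein_comp_iso_le e μ ν) ?_
  simpa using wasserstein_comp_iso_le e.symm (fun a => μ (e a)) (fun a => ν (e a))

lemma kappa_iso [K.LocallyFinite] [K'.LocallyFinite] (e : K ≃g K') (p : ℝ) (x y : V) :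
    kappa K' p (e x) (e y) = kappa K p x y := by
  have key : ∀ w, (fun a => lazyMeasure K' p (e w) (e a)) = lazyMeasure K p w := by
    intro w
    funext a
    have e1 : K'.Adj (e w) (e a) ↔ K.Adj w a := e.map_rel_iff
    have e2 : e a = e w ↔ a = w := e.injective.eq_iff
    by_cases h1 : a = w <;> by_cases h2 : K.Adj w a <;> simp [lazyMeasure, e1, e2, h1, h2]
  rw [kappa, kappa, ← wasserstein_comp_iso e, key, key]

lemma kappaLLY_iso [K.LocallyFinite] [K'.LocallyFinite] (e : K ≃g K') (x y : V) :
    kappaLLY K' (e x) (e y) = kappaLLY K x y := by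
  simp only [kappaLLY, kappa_iso e]

/-- The strong product is commutative up to isomorphism. -/
def strongProdComm {V : Type*} {W : Type*} (G : SimpleGraph V) (H : SimpleGraph W) :
    strongProd G H ≃g strongProd H G where
  toEquiv := Equiv.prodComm V W
  map_rel_iff' {a b} := by
    simp only [strongProd, Equiv.prodComm_apply, Prod.fst_swap, Prod.snd_swap]
    tauto

end Iso

end OllivierRicci

theorem corollary5p4 {V : Type*} {W : Type*} (G : SimpleGraph V) (H : SimpleGraph W)
    [G.LocallyFinite] [H.LocallyFinite] (hG : G.Connected) (hH : H.Connected)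
    (dG dH : ℕ) (hdG : G.IsRegularOfDegree dG) (hdH : H.IsRegularOfDegree dH) :
    ((∀ x₁ x₂, G.Adj x₁ x₂ → 0 ≤ OllivierRicci.kappa G 0 x₁ x₂) →
      (∀ y₁ y₂, H.Adj y₁ y₂ → 0 ≤ OllivierRicci.kappa H 0 y₁ y₂) →
        (∀ x₁ x₂ y, G.Adj x₁ x₂ →
          0 ≤ OllivierRicci.kappa (OllivierRicci.strongProd G H) 0 (x₁, y) (x₂, y)) ∧
        (∀ x y₁ y₂, H.Adj y₁ y₂ →
          0 ≤ OllivierRicci.kappa (OllivierRicci.strongProd G H) 0 (x, y₁) (x, y₂))) ∧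
    ((∀ x₁ x₂, G.Adj x₁ x₂ → 0 ≤ OllivierRicci.kappaLLY G x₁ x₂) →
      (∀ y₁ y₂, H.Adj y₁ y₂ → 0 ≤ OllivierRicci.kappaLLY H y₁ y₂) →
        (∀ x₁ x₂ y, G.Adj x₁ x₂ →
          OllivierRicci.HasKappaLLY (OllivierRicci.strongProd G H) (x₁, y) (x₂, y) ∧
          0 ≤ OllivierRicci.kappaLLY (OllivierRicci.strongProd G H) (x₁, y) (x₂, y)) ∧
        (∀ x y₁ y₂, H.Adj y₁ y₂ →
          OllivierRicci.HasKappaLLY (OllivierRicci.strongProd G H) (x, y₁) (x, y₂) ∧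
          0 ≤ OllivierRicci.kappaLLY (OllivierRicci.strongProd G H) (x, y₁) (x, y₂))) := by
  refine ⟨fun hkG hkH => ⟨fun x₁ x₂ y h => ?_, fun x y₁ y₂ h => ?_⟩,
    fun hkG hkH => ⟨fun x₁ x₂ y h => ?_, fun x y₁ y₂ h => ?_⟩⟩
  · exact OllivierRicci.kappa_zero_horizontal_nonneg hG hdG h (hkG _ _ h) y
  · rw [← OllivierRicci.kappa_iso (OllivierRicci.strongProdComm G H)]
    exact OllivierRicci.kappa_zero_horizontal_nonneg hH hdH h (hkH _ _ h) x
  · exact ⟨OllivierRicci.hasKappaLLY_of_adj (Or.inl ⟨h, rfl⟩),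
      OllivierRicci.kappaLLY_horizontal_nonneg hG hdG h (hkG _ _ h) y⟩
  · refine ⟨OllivierRicci.hasKappaLLY_of_adj (Or.inr (Or.inl ⟨rfl, h⟩)), ?_⟩
    rw [← OllivierRicci.kappaLLY_iso (OllivierRicci.strongProdComm G H)]
    exact OllivierRicci.kappaLLY_horizontal_nonneg hH hdH h (hkH _ _ h) x
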